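/- For a closed set $\mathcal S\subseteq\mathbb R^d$, let $\pi_{\mathcal S}(x)$ be the set of points of $\mathcal S$ closest to $x$, and let the medial axis $\mathrm{ax}(\mathcal S)$ be the set of points $x\in\mathbb R^d$ for which $\pi_{\mathcal S}(x)$ has more than one element. Let $d_H(A,B)=\max\{\sup_{a\in A}d(a,B),\sup_{b\in B}d(b,A)\}\in[0,\infty]$ be the Hausdorff distance (it is $0$ if both sets are empty and $\infty$ if exactly one is). A map is $C^{1,1}$ if it is $C^1$ with Lipschitz derivative, and $\mathrm{Lip}(D\varphi)=\sup_{x\ne y}\|D\varphi(x)-D\varphi(y)\|/|x-y|$, with the operator norm induced by the Euclidean norm. **Theorem.** Let $B\subseteq\mathbb R^d$ be a closed ball of radius $r>0$, and let $\mathcal S\subseteq\mathbb R^d$ be a closed set with $\partial B\subseteq\mathcal S\subseteq B$. Let $\mathcal U$ be the vector space of $C^{1,1}$ maps $\mathbb R^d\to\mathbb R^d$ that vanish outside $B$, normed by $\varphi\mapsto\mathrm{Lip}(D\varphi)$. (i) Let $F=\mathrm{Id}+\varphi$ be a bijection of $\mathbb R^d$ with inverse $\mathrm{Id}+\tilde\varphi$,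 where $\varphi,\tilde\varphi\in\mathcal U$, and put $\varepsilon(F)=\max(\mathrm{Lip}(D\varphi),\mathrm{Lip}(D\tilde\varphi))$. If $r\,\varepsilon(F)\le 1/4$, then $$d_H(\mathrm{ax}(\mathcal S),\mathrm{ax}(F(\mathcal S)))\le(1+\sqrt{50})\,r^2\varepsilon(F)+C\,r^3\varepsilon(F)^2 ,$$ and in particular $d_H(\mathrm{ax}(\mathcal S),\mathrm{ax}(F(\mathcal S)))\le C'\,r^2\varepsilon(F)$. Here $C,C'\ge0$ are absolute constants, independent of $d$, $r$, $B$, $\mathcal S$ and $F$. (ii) The map $F\mapsto\overline{\mathrm{ax}(F(\mathcal S))}$ is Lipschitz for the norm $\mathrm{Lip}(D\,\cdot)$ on every set of diffeomorphisms on which $r\,\varepsilon(F)$ is bounded: for every $M$ there is a constant $C_M\ge0$, depending only on $M$, such that for all $F_1=\mathrm{Id}+\varphi_1$ and $F_2=\mathrm{Id}+\varphi_2$ as in (i), with $r\,\varepsilon(F_1)\le M$ and $r\,\varepsilon(F_2)\le M$ in place of the bound $1/4$, $$d_H\bigl(\overline{\mathrm{ax}(F_1(\mathcal S))},\overline{\mathrm{ax}(F_2(\mathcal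 S))}\bigr)\le C_M\,r^2\,\mathrm{Lip}(D(\varphi_1-\varphi_2)).$$ -/

import Mathlib

/-- The set `π_S(x)` of points of `S` closest to `x`. -/
def closestPoints {d : ℕ} (S : Set (EuclideanSpace ℝ (Fin d))) (x : EuclideanSpace ℝ (Fin d)) :
    Set (EuclideanSpace ℝ (Fin d)) :=
  {q | q ∈ S ∧ ∀ s ∈ S, dist x q ≤ dist x s}

/-- The medial axis `ax(S)`: the points of the ambient space with more than one closest point
in `S`. -/
def medialAxis {d : ℕ} (S : Set (EuclideanSpace ℝ (Fin d))) : Set (EuclideanSpace ℝ (Fin d)) :=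
  {x | 1 < (closestPoints S x).encard}

/-- A `C^{1,1}` map: continuously differentiable with Lipschitz derivative (for the operator norm
on linear maps). -/
def IsC11 {d : ℕ} (φ : EuclideanSpace ℝ (Fin d) → EuclideanSpace ℝ (Fin d)) : Prop :=
  ContDiff ℝ 1 φ ∧ ∃ K : NNReal, LipschitzWith K (fderiv ℝ φ)

/-- `Lip(Dφ)`, the supremum over `x ≠ y` of `‖Dφ(x) - Dφ(y)‖ / |x - y|`, with the operator norm.
The quotients are bounded when `φ` is `C^{1,1}`; the supremum is `0` in dimension `0`. -/
noncomputable def lipDeriv {d : ℕ}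
    (φ : EuclideanSpace ℝ (Fin d) → EuclideanSpace ℝ (Fin d)) : ℝ :=
  ⨆ p : {p : EuclideanSpace ℝ (Fin d) × EuclideanSpace ℝ (Fin d) // p.1 ≠ p.2},
    ‖fderiv ℝ φ p.1.1 - fderiv ℝ φ p.1.2‖ / ‖p.1.1 - p.1.2‖

/-- The space of displacement fields: the `C^{1,1}` maps that vanish outside the closed ball with
centre `z` and radius `r`. -/
def displacementFields {d : ℕ} (z : EuclideanSpace ℝ (Fin d)) (r : ℝ) :
    Set (EuclideanSpace ℝ (Fin d) → EuclideanSpace ℝ (Fin d)) :=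
  {φ | IsC11 φ ∧ ∀ x, x ∉ Metric.closedBall z r → φ x = 0}

/-- The deformation `Id + φ` with displacement field `φ`. -/
def deformation {d : ℕ} (φ : EuclideanSpace ℝ (Fin d) → EuclideanSpace ℝ (Fin d)) :
    EuclideanSpace ℝ (Fin d) → EuclideanSpace ℝ (Fin d) :=
  fun x => x + φ x

/-- `Id + φ` is a `C^{1,1}` diffeomorphism with inverse `Id + ψ`, where `φ` and `ψ` are
displacement fields supported in the closed ball with centre `z` and radius `r`. -/
structure IsDeformationPair {d : ℕ} (z : EuclideanSpace ℝ (Fin d)) (r : ℝ)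
    (φ ψ : EuclideanSpace ℝ (Fin d) → EuclideanSpace ℝ (Fin d)) : Prop where
  mem_left : φ ∈ displacementFields z r
  mem_right : ψ ∈ displacementFields z r
  leftInverse : Function.LeftInverse (deformation ψ) (deformation φ)
  rightInverse : Function.RightInverse (deformation ψ) (deformation φ)

/-- The size `ε = max (Lip(Dφ), Lip(Dψ))` of a deformation with displacement field `φ` whose
inverse has displacement field `ψ`. -/
noncomputable def deformationSize {d : ℕ}
    (φ ψ : EuclideanSpace ℝ (Fin d) → EuclideanSpace ℝ (Fin d)) : ℝ :=
  max (lipDeriv φ) (lipDeriv ψ)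

/-- `S` is a closed set inside the closed ball with centre `z` and radius `r > 0`, and it contains
the bounding sphere. -/
structure HasBoundingSphere {d : ℕ} (S : Set (EuclideanSpace ℝ (Fin d)))
    (z : EuclideanSpace ℝ (Fin d)) (r : ℝ) : Prop where
  isClosed : IsClosed S
  radius_pos : 0 < r
  subset_ball : S ⊆ Metric.closedBall z r
  sphere_subset : Metric.sphere z r ⊆ S

/-!
Off the closed medial axis the distance to a closed set `A` grows at unit rate in some direction,
and this growth persists until the closed medial axis is reached. Hence, if a normal ray
`p + τ • N` of `A` has `p` as a nearest point for small `τ`, the last such point of the ray lies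
in the closed medial axis.

Let `x` be in the medial axis of `F(A)`, with nearest points `F p` and `F q`, and follow the ray of
`A` from `p` in the direction `N = DF(p)ᵀ (x - F p)`. With `e = r * Lip(Dφ)`, the inequality saying
that no point of `F(A)` is closer to `x` than `F p` becomes the same inequality for `A` up to a
factor `1 + 4 * e + e ^ 2`, and the equality at `F q` survives up to a factor `1 - 4 * e + e ^ 2`.
So the ray meets the closed medial axis at a parameter `τ = 1 + O(e)`, at distance
`r * (6 * e + O(e ^ 2))` from `x`. For large `e` there is nothing to prove: both medial axes lie in
the ball and they are empty simultaneously. Two deformations `F₁`, `F₂` of `S` are compared through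
`F₂ ∘ F₁⁻¹ = Id + (φ₂ - φ₁) ∘ F₁⁻¹`, whose size is controlled by `Lip(D(φ₁ - φ₂))`.
-/

open Metric Filter Topology
open scoped RealInnerProductSpace InnerProduct

section NearestPoints

theorem eventually_forall_mem_of_dist_eq_infDist {X : Type*} [PseudoMetricSpace X] [ProperSpace X]
    {A U : Set X} {x : X} (hA : IsClosed A) (hU : IsOpen U)
    (hx : ∀ a ∈ A, dist x a = infDist x A → a ∈ U) :
    ∀ᶠ y in 𝓝 x, ∀ a ∈ A, dist y a = infDist y A → a ∈ U := by
  rcases (A \ U).eq_empty_or_nonempty with hAU | hAU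
  · exact .of_forall fun y a ha _ => Set.sdiff_eq_empty.1 hAU ha
  have hlt : infDist x A < infDist x (A \ U) := by
    obtain ⟨b, hb, hxb⟩ := (hA.sdiff hU).exists_infDist_eq_dist hAU x
    exact (infDist_le_infDist_of_subset Set.sdiff_subset hAU).lt_of_ne
      fun heq => hb.2 (hx b hb.1 (hxb.symm.trans heq.symm))
  filter_upwards [(continuous_infDist_pt A).continuousAt.eventually_lt
    (continuous_infDist_pt (A \ U)).continuousAt hlt] with y hy a ha hya
  by_contra haU
  exact hy.not_ge (hya ▸ infDist_le_dist_of_mem ⟨ha, haU⟩)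

variable {E : Type*} [NormedAddCommGroup E] [InnerProductSpace ℝ E]

theorem dist_sq_eq_dist_sq_sub_two_mul_inner_add (x p a : E) :
    dist x a ^ 2 = dist x p ^ 2 - 2 * ⟪x - p, a - p⟫ + ‖a - p‖ ^ 2 := by
  rw [dist_eq_norm, dist_eq_norm, ← norm_sub_sq_real, sub_sub_sub_cancel_right]

theorem dist_le_dist_iff_two_mul_inner_le {x p a : E} :
    dist x p ≤ dist x a ↔ 2 * ⟪x - p, a - p⟫ ≤ ‖a - p‖ ^ 2 := by
  rw [← sq_le_sq₀ dist_nonneg dist_nonneg, dist_sq_eq_dist_sq_sub_two_mul_inner_add x p a]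
  constructor <;> intro h <;> linarith

theorem dist_le_dist_iff_le_two_mul_inner {x p a : E} :
    dist x a ≤ dist x p ↔ ‖a - p‖ ^ 2 ≤ 2 * ⟪x - p, a - p⟫ := by
  rw [← sq_le_sq₀ dist_nonneg dist_nonneg, dist_sq_eq_dist_sq_sub_two_mul_inner_add x p a]
  constructor <;> intro h <;> linarith

theorem norm_add_mul_lt_norm_add_smul {u w : E} {η s : ℝ} (hη₀ : 0 ≤ η) (hη₁ : η ≤ 1) (hs : 0 < s)
    (hwu : ‖w‖ ≤ ‖u‖) (hinner : η * ‖w‖ ^ 2 < ⟪w, u⟫) :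
    ‖w‖ + η * (s * ‖w‖) < ‖u + s • w‖ := by
  refine lt_of_pow_lt_pow_left₀ 2 (norm_nonneg _) ?_
  calc (‖w‖ + η * (s * ‖w‖)) ^ 2
      = ‖w‖ ^ 2 + 2 * s * (η * ‖w‖ ^ 2) + η ^ 2 * (s * ‖w‖) ^ 2 := by ring
    _ < ‖u‖ ^ 2 + 2 * s * ⟪w, u⟫ + 1 * (s * ‖w‖) ^ 2 := by
        refine add_lt_add_of_lt_of_le (add_lt_add_of_le_of_lt ?_ ?_) ?_ <;> gcongr
        exact pow_le_one₀ hη₀ hη₁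
    _ = ‖u + s • w‖ ^ 2 := by
        rw [norm_add_sq_real, inner_smul_right, real_inner_comm, norm_smul,
          Real.norm_of_nonneg hs.le]
        ring

/- Walking away from the unique nearest point `q`, the nearest points of `x + s • (x - q)` stay
near `q`, so the distance to `A` grows at almost unit rate. -/
theorem frequently_infDist_add_mul_dist_lt [ProperSpace E] {A : Set E} {x : E} (hA : IsClosed A)
    (hne : A.Nonempty) (hxA : x ∉ A) (hunique : {a ∈ A | dist x a = infDist x A}.Subsingleton)
    {η : ℝ} (hη₀ : 0 ≤ η) (hη₁ : η < 1) :
    ∃ᶠ y in 𝓝 x, infDist x A + η * dist y x < infDist y A := by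
  obtain ⟨q, hqA, hxq⟩ := hA.exists_infDist_eq_dist hne x
  have hnear : ∀ᶠ y in 𝓝 x, ∀ a ∈ A, dist y a = infDist y A →
      η * ‖x - q‖ ^ 2 < ⟪x - q, x - a⟫ := by
    refine eventually_forall_mem_of_dist_eq_infDist
      (U := {a | η * ‖x - q‖ ^ 2 < ⟪x - q, x - a⟫}) hA
      (isOpen_lt continuous_const (by fun_prop)) fun a ha hxa => ?_
    obtain rfl : a = q := hunique ⟨ha, hxa⟩ ⟨hqA, hxq.symm⟩
    have hpos : 0 < ‖x - a‖ := norm_sub_pos_iff.2 fun h => hxA (h ▸ ha)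
    rw [Set.mem_ofPred_eq, real_inner_self_eq_norm_sq]
    exact mul_lt_of_lt_one_left (by positivity) hη₁
  have hray : Tendsto (fun s : ℝ => x + s • (x - q)) (𝓝[>] 0) (𝓝 x) := by
    refine tendsto_nhdsWithin_of_tendsto_nhds ?_
    exact Continuous.tendsto' (by fun_prop) _ _ (by simp)
  refine hray.frequently (Eventually.frequently ?_)
  filter_upwards [hray.eventually hnear, self_mem_nhdsWithin] with s hs hs₀
  obtain ⟨a, ha, hya⟩ := hA.exists_infDist_eq_dist hne (x + s • (x - q))
  have hxa : ‖x - q‖ ≤ ‖x - a‖ := by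
    rw [← dist_eq_norm, ← dist_eq_norm, ← hxq]
    exact infDist_le_dist_of_mem ha
  rw [hya, hxq, dist_self_add_left, dist_eq_norm, dist_eq_norm, add_sub_right_comm, norm_smul,
    Real.norm_of_nonneg (le_of_lt hs₀)]
  exact norm_add_mul_lt_norm_add_smul hη₀ hη₁.le hs₀ hxa (hs a ha hya.symm)

end NearestPoints

section MedialAxis

variable {d : ℕ} {A : Set (EuclideanSpace ℝ (Fin d))} {x p q N : EuclideanSpace ℝ (Fin d)}

theorem closestPoints_eq_setOf_dist_eq_infDist (A : Set (EuclideanSpace ℝ (Fin d)))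
    (x : EuclideanSpace ℝ (Fin d)) : closestPoints A x = {q ∈ A | dist x q = infDist x A} :=
  Set.ext fun q => and_congr_right fun hq =>
    ⟨fun h => le_antisymm ((le_infDist ⟨q, hq⟩).2 fun {s} hs => h s hs) (infDist_le_dist_of_mem hq),
      fun h _ hs => h ▸ infDist_le_dist_of_mem hs⟩

theorem notMem_medialAxis_iff : x ∉ medialAxis A ↔ (closestPoints A x).Subsingleton := by
  rw [← Set.encard_le_one_iff_subsingleton, ← not_lt]
  rfl

theorem disjoint_medialAxis (A : Set (EuclideanSpace ℝ (Fin d))) : Disjoint A (medialAxis A) := by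
  refine Set.disjoint_left.2 fun x hx => notMem_medialAxis_iff.2 ?_
  refine Set.subsingleton_of_forall_eq x fun q hq => ?_
  exact (dist_le_zero.1 ((hq.2 x hx).trans_eq (dist_self x))).symm

theorem frequently_infDist_add_mul_dist_lt_of_notMem_medialAxis (hA : IsClosed A)
    (hne : A.Nonempty) (hxA : x ∉ A) (hx : x ∉ medialAxis A) {η : ℝ} (hη₀ : 0 ≤ η) (hη₁ : η < 1) :
    ∃ᶠ y in 𝓝 x, infDist x A + η * dist y x < infDist y A := by
  rw [notMem_medialAxis_iff, closestPoints_eq_setOf_dist_eq_infDist] at hx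
  exact frequently_infDist_add_mul_dist_lt hA hne hxA hx hη₀ hη₁

theorem mem_medialAxis_of_isLocalMax_infDist (hA : IsClosed A) (hne : A.Nonempty) (hxA : x ∉ A)
    (hmax : IsLocalMax (infDist · A) x) : x ∈ medialAxis A := by
  by_contra hx
  obtain ⟨y, hlt, hle⟩ := ((frequently_infDist_add_mul_dist_lt_of_notMem_medialAxis hA hne hxA hx
    le_rfl zero_lt_one).and_eventually hmax).exists
  linarith

/- At an interior maximum of `infDist · A - η * dist · x` the distance to `A` could not grow at a
rate above `η`, so the maximum is attained on the boundary of the ball. -/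
theorem exists_mem_closedBall_infDist_add_mul_le (hA : IsClosed A) (hne : A.Nonempty) (hxA : x ∉ A)
    {δ : ℝ} (hδ : 0 ≤ δ) (hball : Disjoint (ball x δ) (medialAxis A)) {η : ℝ} (hη₀ : 0 ≤ η)
    (hη₁ : η < 1) : ∃ y ∈ closedBall x δ, infDist x A + η * δ ≤ infDist y A := by
  obtain ⟨y, hy, hmax⟩ := (isCompact_closedBall x δ).exists_isMaxOn ⟨x, mem_closedBall_self hδ⟩
    (f := fun y => infDist y A - η * dist y x) (by fun_prop)
  have hxy : infDist x A + η * dist y x ≤ infDist y A := by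
    have := hmax (mem_closedBall_self hδ)
    simp only [Set.mem_ofPred_eq, dist_self, mul_zero, sub_zero] at this
    linarith
  refine ⟨y, hy, ?_⟩
  obtain hyδ | hyδ := (mem_closedBall.1 hy).eq_or_lt
  · rwa [hyδ] at hxy
  have hyA : y ∉ A := by
    rw [hA.notMem_iff_infDist_pos hne] at hxA ⊢
    exact hxA.trans_le ((le_add_of_nonneg_right (by positivity)).trans hxy)
  obtain ⟨y', hlt, hy'⟩ := ((frequently_infDist_add_mul_dist_lt_of_notMem_medialAxis hA hne hyA
    (Set.disjoint_left.1 hball hyδ) hη₀ hη₁).and_eventually (isOpen_ball.mem_nhds hyδ)).exists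
  have hle : infDist y' A - η * dist y' x ≤ infDist y A - η * dist y x :=
    hmax (ball_subset_closedBall hy')
  have htri : η * dist y' x ≤ η * (dist y' y + dist y x) := by gcongr; exact dist_triangle _ _ _
  linarith

theorem exists_mem_closedBall_infDist_add_le (hA : IsClosed A) (hne : A.Nonempty) (hxA : x ∉ A)
    {δ : ℝ} (hδ : 0 ≤ δ) (hball : Disjoint (ball x δ) (medialAxis A)) :
    ∃ y ∈ closedBall x δ, infDist x A + δ ≤ infDist y A := by
  obtain ⟨y, hy, hmax⟩ := (isCompact_closedBall x δ).exists_isMaxOn ⟨x, mem_closedBall_self hδ⟩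
    (continuous_infDist_pt A).continuousOn
  refine ⟨y, hy, ?_⟩
  have hlim : Tendsto (fun η : ℝ => infDist x A + η * δ) (𝓝[<] 1) (𝓝 (infDist x A + δ)) :=
    tendsto_nhdsWithin_of_tendsto_nhds (Continuous.tendsto' (by fun_prop) _ _ (by simp))
  refine le_of_tendsto hlim ?_
  filter_upwards [Ico_mem_nhdsLT zero_lt_one] with η hη
  obtain ⟨y', hy', hle⟩ :=
    exists_mem_closedBall_infDist_add_mul_le hA hne hxA hδ hball hη.1 hη.2
  exact hle.trans (hmax hy')

theorem exists_gt_mem_closestPoints_add_smul (hA : IsClosed A) {τ : ℝ} (hτ : 0 < τ) (hN : N ≠ 0)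
    (hp : p ∈ closestPoints A (p + τ • N)) (hax : p + τ • N ∉ closure (medialAxis A)) :
    ∃ τ' > τ, p ∈ closestPoints A (p + τ' • N) := by
  set c := p + τ • N with hc
  have hpc : p ≠ c := by simpa [hc] using ⟨hτ.ne', hN⟩
  have hcA : c ∉ A := fun h => hpc (dist_le_zero.1 ((hp.2 c h).trans_eq (dist_self c))).symm
  obtain ⟨δ, hδ, hball⟩ := Metric.mem_nhds_iff.1 (isClosed_closure.isOpen_compl.mem_nhds hax)
  obtain ⟨y, hy, hle⟩ := exists_mem_closedBall_infDist_add_le hA ⟨p, hp.1⟩ hcA hδ.le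
    ((Set.subset_compl_iff_disjoint_right.1 hball).mono_right subset_closure)
  have hcp : dist c p = infDist c A := (closestPoints_eq_setOf_dist_eq_infDist A c ▸ hp).2
  have hyp : infDist y A ≤ dist y p := infDist_le_dist_of_mem hp.1
  have hyc : dist y c ≤ δ := hy
  have htri := dist_triangle y c p
  have hcy : c ≠ y := by
    rintro rfl
    linarith
  have hbtw : Sbtw ℝ p c y := by
    refine ⟨dist_add_dist_eq_iff.1 ?_, hpc.symm, hcy⟩
    rw [dist_comm p c, dist_comm c y, dist_comm p y]
    linarith
  obtain ⟨κ, hκ, rfl⟩ := hbtw.right_mem_image_Ioi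
  have hline : AffineMap.lineMap p c κ = p + (κ * τ) • N := by
    rw [AffineMap.lineMap_apply_module', hc, add_sub_cancel_left, smul_smul, add_comm]
  refine ⟨κ * τ, lt_mul_of_one_lt_left hτ hκ, ?_⟩
  rw [← hline, closestPoints_eq_setOf_dist_eq_infDist]
  exact ⟨hp.1, by linarith⟩

theorem mem_closestPoints_add_smul_iff {τ : ℝ} :
    p ∈ closestPoints A (p + τ • N) ↔ p ∈ A ∧ ∀ a ∈ A, 2 * τ * ⟪N, a - p⟫ ≤ ‖a - p‖ ^ 2 := by
  refine and_congr_right fun _ => forall₂_congr fun a _ => ?_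
  rw [dist_le_dist_iff_two_mul_inner_le, add_sub_cancel_left, real_inner_smul_left, mul_assoc]

theorem isClosed_setOf_mem_closestPoints_add_smul (A : Set (EuclideanSpace ℝ (Fin d)))
    (p N : EuclideanSpace ℝ (Fin d)) : IsClosed {τ : ℝ | p ∈ closestPoints A (p + τ • N)} := by
  simp only [mem_closestPoints_add_smul_iff, Set.ofPred_and, Set.ofPred_forall]
  exact isClosed_const.inter
    (isClosed_biInter fun a _ => isClosed_le (by fun_prop) continuous_const)

theorem le_inv_of_mem_closestPoints_add_smul {τ b : ℝ} (hp : p ∈ closestPoints A (p + τ • N))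
    (hq : q ∈ A) (hqp : q ≠ p) (hb : 0 < b) (hge : b * ‖q - p‖ ^ 2 ≤ 2 * ⟪N, q - p⟫) :
    τ ≤ b⁻¹ := by
  obtain hτ | hτ := le_total τ 0
  · exact hτ.trans (inv_nonneg.2 hb.le)
  have hqp' : 0 < ‖q - p‖ := norm_sub_pos_iff.2 hqp
  rw [← one_div, le_div_iff₀ hb]
  refine le_of_mul_le_mul_right ?_ (pow_pos hqp' 2)
  calc τ * b * ‖q - p‖ ^ 2 = τ * (b * ‖q - p‖ ^ 2) := mul_assoc _ _ _
    _ ≤ τ * (2 * ⟪N, q - p⟫) := by gcongr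
    _ = 2 * τ * ⟪N, q - p⟫ := by ring
    _ ≤ ‖q - p‖ ^ 2 := (mem_closestPoints_add_smul_iff.1 hp).2 q hq
    _ = 1 * ‖q - p‖ ^ 2 := (one_mul _).symm

theorem exists_add_smul_mem_closure_medialAxis (hA : IsClosed A) (hp : p ∈ A) (hq : q ∈ A)
    (hqp : q ≠ p) {a b : ℝ} (ha : 0 < a) (hb : 0 < b)
    (hle : ∀ s ∈ A, 2 * ⟪N, s - p⟫ ≤ a * ‖s - p‖ ^ 2) (hge : b * ‖q - p‖ ^ 2 ≤ 2 * ⟪N, q - p⟫) :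
    ∃ τ, a⁻¹ ≤ τ ∧ τ ≤ b⁻¹ ∧ p + τ • N ∈ closure (medialAxis A) := by
  have hN : N ≠ 0 := by
    rintro rfl
    have hqp' : 0 < ‖q - p‖ := norm_sub_pos_iff.2 hqp
    have : 0 < b * ‖q - p‖ ^ 2 := by positivity
    simp only [inner_zero_left, mul_zero] at hge
    exact this.not_ge hge
  let K : Set ℝ := {τ | p ∈ closestPoints A (p + τ • N)}
  have ha_mem : a⁻¹ ∈ K := by
    refine mem_closestPoints_add_smul_iff.2 ⟨hp, fun s hs => ?_⟩
    rw [mul_comm 2, mul_assoc, inv_mul_le_iff₀ ha]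
    exact hle s hs
  have hb_upper : b⁻¹ ∈ upperBounds K :=
    fun τ hτ => le_inv_of_mem_closestPoints_add_smul hτ hq hqp hb hge
  have hsup : sSup K ∈ K :=
    (isClosed_setOf_mem_closestPoints_add_smul A p N).csSup_mem ⟨_, ha_mem⟩ ⟨_, hb_upper⟩
  have ha_le : a⁻¹ ≤ sSup K := le_csSup ⟨_, hb_upper⟩ ha_mem
  refine ⟨sSup K, ha_le, hb_upper hsup, ?_⟩
  by_contra hax
  obtain ⟨τ, hτ, hmem⟩ :=
    exists_gt_mem_closestPoints_add_smul hA ((inv_pos.2 ha).trans_le ha_le) hN hsup hax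
  exact hτ.not_ge (le_csSup ⟨_, hb_upper⟩ hmem)

end MedialAxis

section BoundingSphere

variable {E : Type*} [NormedAddCommGroup E] [NormedSpace ℝ E]

theorem exists_mem_sphere_dist_eq [Nontrivial E] {r : ℝ} (hr : 0 ≤ r) (z x : E) :
    ∃ s ∈ sphere z r, dist x s = |dist x z - r| := by
  obtain ⟨v, hv, hx⟩ : ∃ v : E, ‖v‖ = 1 ∧ x = z + dist x z • v := by
    obtain rfl | hxz := eq_or_ne x z
    · obtain ⟨v, hv⟩ := exists_norm_eq E zero_le_one
      exact ⟨v, hv, by simp⟩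
    · refine ⟨(dist x z)⁻¹ • (x - z), ?_, ?_⟩
      · rw [dist_eq_norm]
        exact norm_smul_inv_norm (𝕜 := ℝ) (sub_ne_zero.2 hxz)
      · rw [smul_inv_smul₀ (dist_ne_zero.2 hxz), add_sub_cancel]
  refine ⟨z + r • v, by simp [norm_smul, hv, abs_of_nonneg hr], ?_⟩
  conv_lhs => rw [hx]
  rw [dist_add_left, dist_eq_norm, ← sub_smul, norm_smul, hv, mul_one, Real.norm_eq_abs]

theorem exists_notMem_ball_dist_le [Nontrivial E] {r : ℝ} (hr : 0 ≤ r) (z x : E) :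
    ∃ s ∉ ball z r, dist x s ≤ r := by
  by_cases hx : x ∈ ball z r
  · obtain ⟨s, hs, hxs⟩ := exists_mem_sphere_dist_eq hr z x
    refine ⟨s, (mem_sphere.1 hs).not_lt, ?_⟩
    rw [hxs, abs_of_neg (sub_neg.2 (mem_ball.1 hx))]
    linarith [dist_nonneg (x := x) (y := z)]
  · exact ⟨x, hx, by simpa using hr⟩

variable {d : ℕ} {S : Set (EuclideanSpace ℝ (Fin d))} {x z : EuclideanSpace ℝ (Fin d)} {r : ℝ}

theorem nontrivial_of_mem_medialAxis (hx : x ∈ medialAxis S) :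
    Nontrivial (EuclideanSpace ℝ (Fin d)) := by
  obtain ⟨p, q, -, -, hpq⟩ := Set.one_lt_encard_iff.1 hx
  exact ⟨p, q, hpq⟩

namespace HasBoundingSphere

/- Two nearest points of a point `x` outside the ball would have their midpoint in the ball, but
strictly closer to `x` than the bounding sphere. -/
theorem medialAxis_subset_ball (hS : HasBoundingSphere S z r) : medialAxis S ⊆ ball z r := by
  intro x hx
  have := nontrivial_of_mem_medialAxis hx
  obtain ⟨p, q, hp, hq, hpq⟩ := Set.one_lt_encard_iff.1 hx
  rw [mem_ball]
  by_contra! hxr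
  obtain ⟨s, hs, hxs⟩ := exists_mem_sphere_dist_eq hS.radius_pos.le z x
  rw [abs_of_nonneg (sub_nonneg.2 hxr)] at hxs
  have hclose {a} (ha : a ∈ closestPoints S x) : a ∈ closedBall x (dist x z - r) :=
    mem_closedBall'.2 (hxs ▸ ha.2 s (hS.sphere_subset hs))
  have hmid_lt : midpoint ℝ p q ∈ ball x (dist x z - r) :=
    openSegment_subset_ball_of_ne (hclose hp) (hclose hq) hpq (midpoint_mem_openSegment p q)
  have hmid_le : midpoint ℝ p q ∈ closedBall z r :=
    (convex_closedBall z r).midpoint_mem (hS.subset_ball hp.1) (hS.subset_ball hq.1)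
  linarith [dist_triangle x (midpoint ℝ p q) z, mem_ball'.1 hmid_lt, mem_closedBall.1 hmid_le]

theorem infDist_le_of_mem_medialAxis (hS : HasBoundingSphere S z r) (hx : x ∈ medialAxis S) :
    infDist x S ≤ r := by
  have := nontrivial_of_mem_medialAxis hx
  obtain ⟨s, hs, hxs⟩ := exists_mem_sphere_dist_eq hS.radius_pos.le z x
  refine (infDist_le_dist_of_mem (hS.sphere_subset hs)).trans ?_
  rw [hxs, abs_of_neg (sub_neg.2 (hS.medialAxis_subset_ball hx))]
  linarith [dist_nonneg (x := x) (y := z)]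

theorem medialAxis_nonempty_iff (hS : HasBoundingSphere S z r) :
    (medialAxis S).Nonempty ↔ S.Nonempty ∧ (closedBall z r \ S).Nonempty := by
  constructor
  · rintro ⟨x, hx⟩
    obtain ⟨p, q, hp, -, -⟩ := Set.one_lt_encard_iff.1 hx
    exact ⟨⟨p, hp.1⟩, x, ball_subset_closedBall (hS.medialAxis_subset_ball hx),
      Set.disjoint_right.1 (disjoint_medialAxis S) hx⟩
  · rintro ⟨hne, y, hy, hyS⟩
    obtain ⟨c, hc, hmax⟩ := (isCompact_closedBall z r).exists_isMaxOn ⟨y, hy⟩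
      (continuous_infDist_pt S).continuousOn
    have hcS : c ∉ S := by
      rw [hS.isClosed.notMem_iff_infDist_pos hne] at hyS ⊢
      exact hyS.trans_le (hmax hy)
    have hcz : c ∈ ball z r := (mem_closedBall.1 hc).lt_of_ne fun h => hcS (hS.sphere_subset h)
    exact ⟨c, mem_medialAxis_of_isLocalMax_infDist hS.isClosed hne hcS
      (hmax.isLocalMax (closedBall_mem_nhds_of_mem hcz))⟩

end HasBoundingSphere

end BoundingSphere

section DisplacementFields

section

variable {E F G : Type*} [NormedAddCommGroup E] [NormedSpace ℝ E] [NormedAddCommGroup F]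
  [NormedSpace ℝ F] [NormedAddCommGroup G] [NormedSpace ℝ G]

theorem norm_sub_sub_fderiv_le_of_lipschitzWith_fderiv {f : E → F} {K : NNReal}
    (hf : Differentiable ℝ f) (hK : LipschitzWith K (fderiv ℝ f)) (x y : E) :
    ‖f y - f x - fderiv ℝ f x (y - x)‖ ≤ K * ‖y - x‖ ^ 2 := by
  have := (convex_closedBall x (dist y x)).norm_image_sub_le_of_norm_fderiv_le' (𝕜 := ℝ)
    (C := K * dist y x) (fun u _ => hf u)
    (fun u hu => (hK.norm_sub_le u x).trans (by rw [← dist_eq_norm]; gcongr; exact hu))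
    (mem_closedBall_self dist_nonneg) (mem_closedBall.2 le_rfl)
  rwa [mul_assoc, dist_eq_norm, ← sq] at this

theorem eq_zero_of_continuous_of_notMem_ball {Y : Type*} [TopologicalSpace Y] [T2Space Y] [Zero Y]
    {f : E → Y} {z x : E} {r : ℝ} (hr : r ≠ 0) (hf : Continuous f)
    (h : ∀ y ∉ closedBall z r, f y = 0) (hx : x ∉ ball z r) : f x = 0 := by
  have hcl : IsClosed {y | f y = 0} := isClosed_eq hf continuous_const
  refine (hcl.closure_subset_iff (s := (closedBall z r)ᶜ)).2 h ?_
  rwa [closure_compl, interior_closedBall z hr]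

theorem norm_comp_sub_comp_le (A A' : F →L[ℝ] G) (B B' : E →L[ℝ] F) :
    ‖A ∘L B - A' ∘L B'‖ ≤ ‖A - A'‖ * ‖B‖ + ‖A'‖ * ‖B - B'‖ := by
  calc ‖A ∘L B - A' ∘L B'‖ = ‖(A - A') ∘L B + A' ∘L (B - B')‖ := by
        rw [ContinuousLinearMap.sub_comp, ContinuousLinearMap.comp_sub, sub_add_sub_cancel]
    _ ≤ _ := (norm_add_le _ _).trans (add_le_add (ContinuousLinearMap.opNorm_comp_le _ _)
      (ContinuousLinearMap.opNorm_comp_le _ _))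

end

variable {d : ℕ} {φ ψ η : EuclideanSpace ℝ (Fin d) → EuclideanSpace ℝ (Fin d)}
  {x z : EuclideanSpace ℝ (Fin d)} {r : ℝ}

theorem lipDeriv_nonneg (φ : EuclideanSpace ℝ (Fin d) → EuclideanSpace ℝ (Fin d)) :
    0 ≤ lipDeriv φ :=
  Real.iSup_nonneg fun _ => by positivity

theorem lipDeriv_le {K : NNReal} (hK : LipschitzWith K (fderiv ℝ φ)) : lipDeriv φ ≤ K :=
  Real.iSup_le (fun _ => div_le_of_le_mul₀ (norm_nonneg _) K.2 (hK.norm_sub_le _ _)) K.2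

theorem lipDeriv_sub_comm (φ ψ : EuclideanSpace ℝ (Fin d) → EuclideanSpace ℝ (Fin d)) :
    lipDeriv (φ - ψ) = lipDeriv (ψ - φ) := by
  refine iSup_congr fun p => ?_
  rw [← neg_sub ψ φ, fderiv_neg, fderiv_neg, neg_sub_neg, norm_sub_rev]

namespace IsC11

theorem differentiable (hφ : IsC11 φ) : Differentiable ℝ φ :=
  hφ.1.differentiable one_ne_zero

theorem norm_fderiv_sub_le (hφ : IsC11 φ) (x y : EuclideanSpace ℝ (Fin d)) :
    ‖fderiv ℝ φ x - fderiv ℝ φ y‖ ≤ lipDeriv φ * ‖x - y‖ := by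
  obtain rfl | hxy := eq_or_ne x y
  · simp
  obtain ⟨-, K, hK⟩ := hφ
  rw [← div_le_iff₀ (norm_sub_pos_iff.2 hxy)]
  refine le_ciSup (f := fun p : {p : EuclideanSpace ℝ (Fin d) × EuclideanSpace ℝ (Fin d) //
    p.1 ≠ p.2} => ‖fderiv ℝ φ p.1.1 - fderiv ℝ φ p.1.2‖ / ‖p.1.1 - p.1.2‖) ⟨K, ?_⟩ ⟨(x, y), hxy⟩
  rintro _ ⟨p, rfl⟩
  exact div_le_of_le_mul₀ (norm_nonneg _) K.2 (hK.norm_sub_le _ _)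

theorem lipschitzWith_fderiv (hφ : IsC11 φ) :
    LipschitzWith (lipDeriv φ).toNNReal (fderiv ℝ φ) :=
  lipschitzWith_iff_norm_sub_le.2 fun x y => by
    rw [Real.coe_toNNReal _ (lipDeriv_nonneg φ)]
    exact hφ.norm_fderiv_sub_le x y

theorem norm_sub_sub_fderiv_le (hφ : IsC11 φ) (x y : EuclideanSpace ℝ (Fin d)) :
    ‖φ y - φ x - fderiv ℝ φ x (y - x)‖ ≤ lipDeriv φ * ‖y - x‖ ^ 2 := by
  have := norm_sub_sub_fderiv_le_of_lipschitzWith_fderiv hφ.differentiable hφ.lipschitzWith_fderiv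
    x y
  rwa [Real.coe_toNNReal _ (lipDeriv_nonneg φ)] at this

theorem sub (hφ : IsC11 φ) (hψ : IsC11 ψ) : IsC11 (φ - ψ) := by
  have hfderiv : fderiv ℝ (φ - ψ) = fderiv ℝ φ - fderiv ℝ ψ :=
    funext fun x => fderiv_sub (hφ.differentiable x) (hψ.differentiable x)
  refine ⟨hφ.1.sub hψ.1, (lipDeriv φ).toNNReal + (lipDeriv ψ).toNNReal, ?_⟩
  rw [hfderiv]
  exact hφ.lipschitzWith_fderiv.sub hψ.lipschitzWith_fderiv

end IsC11

theorem sub_mem_displacementFields (hφ : φ ∈ displacementFields z r)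
    (hψ : ψ ∈ displacementFields z r) : φ - ψ ∈ displacementFields z r :=
  ⟨hφ.1.sub hψ.1, fun x hx => by rw [Pi.sub_apply, hφ.2 x hx, hψ.2 x hx, sub_zero]⟩

theorem eq_zero_of_mem_displacementFields (hr : 0 < r) (hφ : φ ∈ displacementFields z r)
    (hx : x ∉ ball z r) : φ x = 0 :=
  eq_zero_of_continuous_of_notMem_ball hr.ne' hφ.1.1.continuous hφ.2 hx

theorem fderiv_eq_zero_of_mem_displacementFields (hr : 0 < r) (hφ : φ ∈ displacementFields z r)
    (hx : x ∉ ball z r) : fderiv ℝ φ x = 0 := by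
  refine eq_zero_of_continuous_of_notMem_ball hr.ne' (hφ.1.1.continuous_fderiv one_ne_zero)
    (fun y hy => ?_) hx
  have hzero : φ =ᶠ[𝓝 y] 0 := by
    filter_upwards [isClosed_closedBall.isOpen_compl.mem_nhds hy] with u hu using hφ.2 u hu
  rw [hzero.fderiv_eq, fderiv_zero, Pi.zero_apply]

theorem norm_fderiv_le_of_mem_displacementFields (hr : 0 < r) (hφ : φ ∈ displacementFields z r)
    (x : EuclideanSpace ℝ (Fin d)) : ‖fderiv ℝ φ x‖ ≤ r * lipDeriv φ := by
  have hlip := lipDeriv_nonneg φ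
  obtain _ | _ := subsingleton_or_nontrivial (EuclideanSpace ℝ (Fin d))
  · rw [Subsingleton.elim (fderiv ℝ φ x) 0, norm_zero]
    positivity
  obtain ⟨s, hs, hxs⟩ := exists_notMem_ball_dist_le hr.le z x
  calc ‖fderiv ℝ φ x‖ = ‖fderiv ℝ φ x - fderiv ℝ φ s‖ := by
        rw [fderiv_eq_zero_of_mem_displacementFields hr hφ hs, sub_zero]
    _ ≤ lipDeriv φ * ‖x - s‖ := hφ.1.norm_fderiv_sub_le x s
    _ ≤ lipDeriv φ * r := by rw [← dist_eq_norm]; gcongr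
    _ = r * lipDeriv φ := mul_comm _ _

theorem norm_sub_le_of_mem_displacementFields (hr : 0 < r) (hφ : φ ∈ displacementFields z r)
    (x y : EuclideanSpace ℝ (Fin d)) : ‖φ x - φ y‖ ≤ r * lipDeriv φ * ‖x - y‖ :=
  convex_univ.norm_image_sub_le_of_norm_fderiv_le (𝕜 := ℝ) (fun u _ => hφ.1.differentiable u)
    (fun u _ => norm_fderiv_le_of_mem_displacementFields hr hφ u) (Set.mem_univ y) (Set.mem_univ x)

theorem norm_le_of_mem_displacementFields (hr : 0 < r) (hφ : φ ∈ displacementFields z r)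
    (x : EuclideanSpace ℝ (Fin d)) : ‖φ x‖ ≤ r * lipDeriv φ * r := by
  have hlip := lipDeriv_nonneg φ
  obtain _ | _ := subsingleton_or_nontrivial (EuclideanSpace ℝ (Fin d))
  · rw [Subsingleton.elim (φ x) 0, norm_zero]
    positivity
  obtain ⟨s, hs, hxs⟩ := exists_notMem_ball_dist_le hr.le z x
  calc ‖φ x‖ = ‖φ x - φ s‖ := by rw [eq_zero_of_mem_displacementFields hr hφ hs, sub_zero]
    _ ≤ r * lipDeriv φ * ‖x - s‖ := norm_sub_le_of_mem_displacementFields hr hφ x s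
    _ ≤ r * lipDeriv φ * r := by rw [← dist_eq_norm]; gcongr

theorem deformation_sub (φ : EuclideanSpace ℝ (Fin d) → EuclideanSpace ℝ (Fin d))
    (x y : EuclideanSpace ℝ (Fin d)) :
    deformation φ x - deformation φ y = (x - y) + (φ x - φ y) :=
  add_sub_add_comm _ _ _ _

theorem norm_deformation_sub_le (hr : 0 < r) (hφ : φ ∈ displacementFields z r)
    (x y : EuclideanSpace ℝ (Fin d)) :
    ‖deformation φ x - deformation φ y‖ ≤ (1 + r * lipDeriv φ) * ‖x - y‖ := by
  rw [deformation_sub]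
  linarith [norm_add_le (x - y) (φ x - φ y), norm_sub_le_of_mem_displacementFields hr hφ x y]

theorem le_norm_deformation_sub (hr : 0 < r) (hφ : φ ∈ displacementFields z r)
    (x y : EuclideanSpace ℝ (Fin d)) :
    (1 - r * lipDeriv φ) * ‖x - y‖ ≤ ‖deformation φ x - deformation φ y‖ := by
  rw [deformation_sub]
  linarith [norm_sub_le_norm_add (x - y) (φ x - φ y),
    norm_sub_le_of_mem_displacementFields hr hφ x y]

theorem contDiff_deformation (hφ : φ ∈ displacementFields z r) : ContDiff ℝ 1 (deformation φ) :=
  contDiff_id.add hφ.1.1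

theorem fderiv_deformation (hφ : φ ∈ displacementFields z r) (x : EuclideanSpace ℝ (Fin d)) :
    fderiv ℝ (deformation φ) x = .id ℝ (EuclideanSpace ℝ (Fin d)) + fderiv ℝ φ x :=
  ((hasFDerivAt_id x).add (hφ.1.differentiable x).hasFDerivAt).fderiv

theorem norm_fderiv_deformation_le (hr : 0 < r) (hφ : φ ∈ displacementFields z r)
    (x : EuclideanSpace ℝ (Fin d)) : ‖fderiv ℝ (deformation φ) x‖ ≤ 1 + r * lipDeriv φ := by
  rw [fderiv_deformation hφ]
  exact norm_add_le_of_le ContinuousLinearMap.norm_id_le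
    (norm_fderiv_le_of_mem_displacementFields hr hφ x)

theorem norm_fderiv_comp_deformation_sub_le (hr : 0 < r) (hη : η ∈ displacementFields z r)
    (hψ : ψ ∈ displacementFields z r) (x y : EuclideanSpace ℝ (Fin d)) :
    ‖fderiv ℝ (η ∘ deformation ψ) x - fderiv ℝ (η ∘ deformation ψ) y‖ ≤
      ((1 + r * lipDeriv ψ) ^ 2 + r * lipDeriv ψ) * lipDeriv η * ‖x - y‖ := by
  have hlipη := lipDeriv_nonneg η
  have hlipψ := lipDeriv_nonneg ψ
  have hchain (u) : fderiv ℝ (η ∘ deformation ψ) u =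
      fderiv ℝ η (deformation ψ u) ∘L fderiv ℝ (deformation ψ) u :=
    fderiv_comp u (hη.1.differentiable _) ((contDiff_deformation hψ).differentiable one_ne_zero u)
  have houter : ‖fderiv ℝ η (deformation ψ x) - fderiv ℝ η (deformation ψ y)‖ ≤
      lipDeriv η * ((1 + r * lipDeriv ψ) * ‖x - y‖) := by
    refine (hη.1.norm_fderiv_sub_le _ _).trans ?_
    gcongr
    exact norm_deformation_sub_le hr hψ x y
  have hinner : ‖fderiv ℝ (deformation ψ) x - fderiv ℝ (deformation ψ) y‖ ≤
      lipDeriv ψ * ‖x - y‖ := by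
    rw [fderiv_deformation hψ, fderiv_deformation hψ, add_sub_add_left_eq_sub]
    exact hψ.1.norm_fderiv_sub_le x y
  rw [hchain, hchain]
  calc _ ≤ _ := norm_comp_sub_comp_le _ _ _ _
    _ ≤ lipDeriv η * ((1 + r * lipDeriv ψ) * ‖x - y‖) * (1 + r * lipDeriv ψ) +
        r * lipDeriv η * (lipDeriv ψ * ‖x - y‖) := by
      gcongr
      · exact norm_fderiv_deformation_le hr hψ x
      · exact norm_fderiv_le_of_mem_displacementFields hr hη _
    _ = _ := by ring

theorem lipschitzWith_fderiv_comp_deformation (hr : 0 < r) (hη : η ∈ displacementFields z r)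
    (hψ : ψ ∈ displacementFields z r) :
    LipschitzWith (((1 + r * lipDeriv ψ) ^ 2 + r * lipDeriv ψ) * lipDeriv η).toNNReal
      (fderiv ℝ (η ∘ deformation ψ)) :=
  lipschitzWith_iff_norm_sub_le.2 fun x y =>
    (norm_fderiv_comp_deformation_sub_le hr hη hψ x y).trans
      (by gcongr; exact Real.le_coe_toNNReal _)

theorem comp_deformation_mem_displacementFields (hr : 0 < r) (hη : η ∈ displacementFields z r)
    (hψ : ψ ∈ displacementFields z r) : η ∘ deformation ψ ∈ displacementFields z r :=
  ⟨⟨hη.1.1.comp (contDiff_deformation hψ), _, lipschitzWith_fderiv_comp_deformation hr hη hψ⟩,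
    fun x hx => by rw [Function.comp_apply, deformation, hψ.2 x hx, add_zero, hη.2 x hx]⟩

theorem lipDeriv_comp_deformation_le (hr : 0 < r) (hη : η ∈ displacementFields z r)
    (hψ : ψ ∈ displacementFields z r) :
    lipDeriv (η ∘ deformation ψ) ≤
      ((1 + r * lipDeriv ψ) ^ 2 + r * lipDeriv ψ) * lipDeriv η := by
  have hlipη := lipDeriv_nonneg η
  have hlipψ := lipDeriv_nonneg ψ
  refine (lipDeriv_le (lipschitzWith_fderiv_comp_deformation hr hη hψ)).trans_eq ?_
  exact Real.coe_toNNReal _ (by positivity)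

end DisplacementFields

section DeformationPairs

variable {d : ℕ} {S : Set (EuclideanSpace ℝ (Fin d))} {z : EuclideanSpace ℝ (Fin d)} {r M : ℝ}
  {φ ψ φ₁ ψ₁ φ₂ ψ₂ : EuclideanSpace ℝ (Fin d) → EuclideanSpace ℝ (Fin d)}

theorem deformationSize_comm (φ ψ : EuclideanSpace ℝ (Fin d) → EuclideanSpace ℝ (Fin d)) :
    deformationSize φ ψ = deformationSize ψ φ :=
  max_comm _ _

theorem lipDeriv_le_deformationSize (φ ψ : EuclideanSpace ℝ (Fin d) → EuclideanSpace ℝ (Fin d)) :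
    lipDeriv φ ≤ deformationSize φ ψ :=
  le_max_left _ _

theorem deformationSize_nonneg (φ ψ : EuclideanSpace ℝ (Fin d) → EuclideanSpace ℝ (Fin d)) :
    0 ≤ deformationSize φ ψ :=
  (lipDeriv_nonneg φ).trans (lipDeriv_le_deformationSize φ ψ)

namespace IsDeformationPair

theorem symm (h : IsDeformationPair z r φ ψ) : IsDeformationPair z r ψ φ :=
  ⟨h.mem_right, h.mem_left, h.rightInverse, h.leftInverse⟩

theorem deformation_mem_closedBall (h : IsDeformationPair z r φ ψ)
    {x : EuclideanSpace ℝ (Fin d)} (hx : x ∈ closedBall z r) :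
    deformation φ x ∈ closedBall z r := by
  by_contra hFx
  have hfix : deformation φ x = x := by
    calc deformation φ x = deformation ψ (deformation φ x) := by
          rw [deformation.eq_1 ψ, h.mem_right.2 _ hFx, add_zero]
      _ = x := h.leftInverse x
  exact hFx (hfix.symm ▸ hx)

theorem image_closedBall (h : IsDeformationPair z r φ ψ) :
    deformation φ '' closedBall z r = closedBall z r :=
  (Set.image_subset_iff.2 fun _ => h.deformation_mem_closedBall).antisymm fun y hy =>
    ⟨deformation ψ y, h.symm.deformation_mem_closedBall hy, h.rightInverse y⟩

end IsDeformationPair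

theorem HasBoundingSphere.image (hS : HasBoundingSphere S z r) (h : IsDeformationPair z r φ ψ) :
    HasBoundingSphere (deformation φ '' S) z r where
  isClosed := by
    rw [Set.image_eq_preimage_of_inverse h.leftInverse h.rightInverse]
    exact hS.isClosed.preimage (contDiff_deformation h.mem_right).continuous
  radius_pos := hS.radius_pos
  subset_ball := (Set.image_mono hS.subset_ball).trans_eq h.image_closedBall
  sphere_subset := fun x hx => ⟨x, hS.sphere_subset hx, by
    rw [deformation, eq_zero_of_mem_displacementFields hS.radius_pos h.mem_left
      (mem_sphere.1 hx).not_lt, add_zero]⟩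

namespace IsDeformationPair

theorem medialAxis_image_nonempty_iff (h : IsDeformationPair z r φ ψ)
    (hS : HasBoundingSphere S z r) :
    (medialAxis (deformation φ '' S)).Nonempty ↔ (medialAxis S).Nonempty := by
  have hdiff : closedBall z r \ deformation φ '' S = deformation φ '' (closedBall z r \ S) := by
    rw [Set.image_sdiff h.leftInverse.injective, h.image_closedBall]
  rw [(hS.image h).medialAxis_nonempty_iff, hS.medialAxis_nonempty_iff, hdiff,
    Set.image_nonempty, Set.image_nonempty]

theorem deformation_comp (h₁ : IsDeformationPair z r φ₁ ψ₁)
    (φ₂ : EuclideanSpace ℝ (Fin d) → EuclideanSpace ℝ (Fin d)) :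
    deformation ((φ₂ - φ₁) ∘ deformation ψ₁) = deformation φ₂ ∘ deformation ψ₁ := by
  funext x
  calc deformation ((φ₂ - φ₁) ∘ deformation ψ₁) x
      = x - deformation φ₁ (deformation ψ₁ x) + deformation φ₂ (deformation ψ₁ x) := by
        simp only [deformation, Function.comp_apply, Pi.sub_apply]
        abel
    _ = deformation φ₂ (deformation ψ₁ x) := by rw [h₁.rightInverse, sub_self, zero_add]

theorem comp (hr : 0 < r) (h₁ : IsDeformationPair z r φ₁ ψ₁) (h₂ : IsDeformationPair z r φ₂ ψ₂) :
    IsDeformationPair z r ((φ₂ - φ₁) ∘ deformation ψ₁) ((φ₁ - φ₂) ∘ deformation ψ₂) where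
  mem_left := comp_deformation_mem_displacementFields hr
    (sub_mem_displacementFields h₂.mem_left h₁.mem_left) h₁.mem_right
  mem_right := comp_deformation_mem_displacementFields hr
    (sub_mem_displacementFields h₁.mem_left h₂.mem_left) h₂.mem_right
  leftInverse := by
    rw [h₁.deformation_comp, h₂.deformation_comp]
    exact h₁.rightInverse.comp h₂.leftInverse
  rightInverse := by
    rw [h₁.deformation_comp, h₂.deformation_comp]
    exact h₂.rightInverse.comp h₁.leftInverse

theorem deformationSize_comp_le (hr : 0 < r) (h₁ : IsDeformationPair z r φ₁ ψ₁)
    (h₂ : IsDeformationPair z r φ₂ ψ₂) (hM₁ : r * lipDeriv ψ₁ ≤ M) (hM₂ : r * lipDeriv ψ₂ ≤ M) :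
    deformationSize ((φ₂ - φ₁) ∘ deformation ψ₁) ((φ₁ - φ₂) ∘ deformation ψ₂) ≤
      ((1 + M) ^ 2 + M) * lipDeriv (φ₁ - φ₂) := by
  have hη := lipDeriv_nonneg (φ₁ - φ₂)
  have h₁₀ : 0 ≤ r * lipDeriv ψ₁ := mul_nonneg hr.le (lipDeriv_nonneg ψ₁)
  have h₂₀ : 0 ≤ r * lipDeriv ψ₂ := mul_nonneg hr.le (lipDeriv_nonneg ψ₂)
  refine max_le ?_ ?_
  · refine (lipDeriv_comp_deformation_le hr
      (sub_mem_displacementFields h₂.mem_left h₁.mem_left) h₁.mem_right).trans ?_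
    rw [lipDeriv_sub_comm φ₂ φ₁]
    gcongr
  · refine (lipDeriv_comp_deformation_le hr
      (sub_mem_displacementFields h₁.mem_left h₂.mem_left) h₂.mem_right).trans ?_
    gcongr

end IsDeformationPair

end DeformationPairs

section NormalTransport

/-- The vector `DF(p)ᵀ v` for the deformation `F = Id + φ`: a vector `v` normal to `F(A)` at `F p`
corresponds to the vector `DF(p)ᵀ v` normal to `A` at `p`, because
`⟪DF(p)ᵀ v, s - p⟫ = ⟪v, DF(p) (s - p)⟫` agrees with `⟪v, F s - F p⟫` to first order. It is not
normalised, so its length records how the distance to `A` along the normal is rescaled. -/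
noncomputable def pullbackNormal {d : ℕ}
    (φ : EuclideanSpace ℝ (Fin d) → EuclideanSpace ℝ (Fin d)) (p v : EuclideanSpace ℝ (Fin d)) :
    EuclideanSpace ℝ (Fin d) :=
  ((fderiv ℝ (deformation φ) p)†) v

variable {d : ℕ} {A : Set (EuclideanSpace ℝ (Fin d))} {z p s x : EuclideanSpace ℝ (Fin d)}
  {r e τ : ℝ} {φ : EuclideanSpace ℝ (Fin d) → EuclideanSpace ℝ (Fin d)}

theorem norm_pullbackNormal_le (hr : 0 < r) (hφ : φ ∈ displacementFields z r)
    (p v : EuclideanSpace ℝ (Fin d)) :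
    ‖pullbackNormal φ p v‖ ≤ (1 + r * lipDeriv φ) * ‖v‖ := by
  refine (((fderiv ℝ (deformation φ) p)†).le_opNorm v).trans ?_
  rw [LinearIsometryEquiv.norm_map]
  gcongr
  exact norm_fderiv_deformation_le hr hφ p

theorem norm_pullbackNormal_sub_le (hr : 0 < r) (hφ : φ ∈ displacementFields z r)
    (p v : EuclideanSpace ℝ (Fin d)) : ‖pullbackNormal φ p v - v‖ ≤ r * lipDeriv φ * ‖v‖ := by
  have hadj : pullbackNormal φ p v - v = ((fderiv ℝ φ p)†) v := by
    rw [pullbackNormal, fderiv_deformation hφ, map_add, ContinuousLinearMap.adjoint_id]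
    exact add_sub_cancel_left _ _
  rw [hadj]
  refine (((fderiv ℝ φ p)†).le_opNorm v).trans ?_
  rw [LinearIsometryEquiv.norm_map]
  gcongr
  exact norm_fderiv_le_of_mem_displacementFields hr hφ p

theorem abs_inner_pullbackNormal_sub_le (hφ : φ ∈ displacementFields z r)
    (p s v : EuclideanSpace ℝ (Fin d)) :
    |⟪pullbackNormal φ p v, s - p⟫ - ⟪v, deformation φ s - deformation φ p⟫| ≤
      ‖v‖ * lipDeriv φ * ‖s - p‖ ^ 2 := by
  have hremainder : deformation φ s - deformation φ p - fderiv ℝ (deformation φ) p (s - p) =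
      φ s - φ p - fderiv ℝ φ p (s - p) := by
    rw [deformation_sub, fderiv_deformation hφ]
    exact add_sub_add_left_eq_sub _ _ _
  rw [pullbackNormal, ContinuousLinearMap.adjoint_inner_left, abs_sub_comm, ← inner_sub_right,
    hremainder, mul_assoc]
  refine (abs_real_inner_le_norm _ _).trans ?_
  gcongr
  exact hφ.1.norm_sub_sub_fderiv_le p s

theorem two_mul_inner_pullbackNormal_le (hr : 0 < r) (hφ : φ ∈ displacementFields z r)
    (he : r * lipDeriv φ ≤ e) (hv : ‖x - deformation φ p‖ ≤ r)
    (h : dist x (deformation φ p) ≤ dist x (deformation φ s)) :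
    2 * ⟪pullbackNormal φ p (x - deformation φ p), s - p⟫ ≤
      (1 + 4 * e + e ^ 2) * ‖s - p‖ ^ 2 := by
  have hlip := lipDeriv_nonneg φ
  have hcomp := (abs_le.1 (abs_inner_pullbackNormal_sub_le hφ p s (x - deformation φ p))).2
  have hsize : ‖x - deformation φ p‖ * lipDeriv φ * ‖s - p‖ ^ 2 ≤ e * ‖s - p‖ ^ 2 := by
    gcongr
    exact (mul_le_mul_of_nonneg_right hv hlip).trans he
  have hexpand : ‖deformation φ s - deformation φ p‖ ^ 2 ≤ ((1 + e) * ‖s - p‖) ^ 2 := by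
    gcongr
    exact (norm_deformation_sub_le hr hφ s p).trans (by gcongr)
  linarith [dist_le_dist_iff_two_mul_inner_le.1 h]

theorem le_two_mul_inner_pullbackNormal (hr : 0 < r) (hφ : φ ∈ displacementFields z r)
    (he : r * lipDeriv φ ≤ e) (he₁ : e ≤ 1) (hv : ‖x - deformation φ p‖ ≤ r)
    (h : dist x (deformation φ s) ≤ dist x (deformation φ p)) :
    (1 - 4 * e + e ^ 2) * ‖s - p‖ ^ 2 ≤
      2 * ⟪pullbackNormal φ p (x - deformation φ p), s - p⟫ := by
  have hlip := lipDeriv_nonneg φ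
  have hcomp := (abs_le.1 (abs_inner_pullbackNormal_sub_le hφ p s (x - deformation φ p))).1
  have hsize : ‖x - deformation φ p‖ * lipDeriv φ * ‖s - p‖ ^ 2 ≤ e * ‖s - p‖ ^ 2 := by
    gcongr
    exact (mul_le_mul_of_nonneg_right hv hlip).trans he
  have hcontract : ((1 - e) * ‖s - p‖) ^ 2 ≤ ‖deformation φ s - deformation φ p‖ ^ 2 := by
    refine pow_le_pow_left₀ (mul_nonneg (sub_nonneg.2 he₁) (norm_nonneg _)) ?_ 2
    exact le_trans (by gcongr) (le_norm_deformation_sub hr hφ s p)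
  linarith [dist_le_dist_iff_le_two_mul_inner.1 h]

theorem abs_sub_one_le_of_inv_le_of_le_inv (he₀ : 0 ≤ e) (he : e ≤ 1 / 4)
    (hle : (1 + 4 * e + e ^ 2)⁻¹ ≤ τ) (hge : τ ≤ (1 - 4 * e + e ^ 2)⁻¹) :
    |τ - 1| ≤ 4 * e + 224 * e ^ 2 := by
  have hpos : 0 < 1 - 4 * e + e ^ 2 := by nlinarith
  have hlower : 1 - (4 * e + 224 * e ^ 2) ≤ (1 + 4 * e + e ^ 2)⁻¹ := by
    rw [← one_div, le_div_iff₀ (by positivity)]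
    nlinarith [pow_nonneg he₀ 2, pow_nonneg he₀ 3, pow_nonneg he₀ 4]
  have hupper : (1 - 4 * e + e ^ 2)⁻¹ ≤ 1 + (4 * e + 224 * e ^ 2) := by
    have hgap : 0 ≤ e ^ 2 * ((1 - 4 * e) * (209 - 56 * e)) :=
      mul_nonneg (sq_nonneg e) (mul_nonneg (by linarith) (by linarith))
    rw [inv_le_iff_one_le_mul₀ hpos]
    linarith
  exact abs_le.2 ⟨by linarith, by linarith⟩

theorem dist_add_smul_pullbackNormal_le (hr : 0 < r) (hφ : φ ∈ displacementFields z r)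
    (he : r * lipDeriv φ ≤ e) (he₄ : e ≤ 1 / 4) (hv : ‖x - deformation φ p‖ ≤ r)
    (hτ : |τ - 1| ≤ 4 * e + 224 * e ^ 2) :
    dist x (p + τ • pullbackNormal φ p (x - deformation φ p)) ≤ r * (6 * e + 284 * e ^ 2) := by
  set v := x - deformation φ p with hv_def
  have hlip₀ := lipDeriv_nonneg φ
  have he₀ : 0 ≤ e := (mul_nonneg hr.le hlip₀).trans he
  have hbase : ‖φ p‖ ≤ e * r := (norm_le_of_mem_displacementFields hr hφ p).trans (by gcongr)
  have hturn : ‖pullbackNormal φ p v - v‖ ≤ e * r :=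
    (norm_pullbackNormal_sub_le hr hφ p v).trans (by gcongr)
  have hstretch : ‖(τ - 1) • pullbackNormal φ p v‖ ≤
      (4 * e + 224 * e ^ 2) * ((1 + e) * r) := by
    rw [norm_smul, Real.norm_eq_abs]
    gcongr
    exact (norm_pullbackNormal_le hr hφ p v).trans (by gcongr)
  have hcubic : e ^ 3 ≤ 1 / 4 * e ^ 2 := by nlinarith [sq_nonneg e]
  calc dist x (p + τ • pullbackNormal φ p v)
      = ‖-φ p + (pullbackNormal φ p v - v) + (τ - 1) • pullbackNormal φ p v‖ := by
        rw [dist_comm, dist_eq_norm]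
        congr 1
        rw [sub_smul, one_smul]
        nth_rw 3 [hv_def]
        rw [deformation]
        abel
    _ ≤ ‖φ p‖ + ‖pullbackNormal φ p v - v‖ + ‖(τ - 1) • pullbackNormal φ p v‖ :=
        norm_add₃_le.trans_eq (by rw [norm_neg])
    _ ≤ e * r + e * r + (4 * e + 224 * e ^ 2) * ((1 + e) * r) := by gcongr
    _ = r * (6 * e + 228 * e ^ 2 + 224 * e ^ 3) := by ring
    _ ≤ r * (6 * e + 284 * e ^ 2) := mul_le_mul_of_nonneg_left (by linarith) hr.le

theorem exists_mem_closure_medialAxis_dist_le (hr : 0 < r) (hφ : φ ∈ displacementFields z r)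
    (he : r * lipDeriv φ ≤ e) (he₄ : e ≤ 1 / 4) (hA : IsClosed A)
    (hx : x ∈ medialAxis (deformation φ '' A)) (hxr : infDist x (deformation φ '' A) ≤ r) :
    ∃ y ∈ closure (medialAxis A), dist x y ≤ r * (6 * e + 284 * e ^ 2) := by
  have he₀ : 0 ≤ e := (mul_nonneg hr.le (lipDeriv_nonneg φ)).trans he
  obtain ⟨_, _, hFp, hFq, hpq⟩ := Set.one_lt_encard_iff.1 hx
  obtain ⟨⟨p, hp, rfl⟩, hp_le⟩ := id hFp
  obtain ⟨⟨q, hq, rfl⟩, hq_le⟩ := id hFq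
  have hv : ‖x - deformation φ p‖ ≤ r := by
    rw [closestPoints_eq_setOf_dist_eq_infDist] at hFp
    rw [← dist_eq_norm]
    exact hFp.2.trans_le hxr
  obtain ⟨τ, hle, hge, hτ⟩ := exists_add_smul_mem_closure_medialAxis hA hp hq
    (fun hqp => hpq (congrArg _ hqp.symm)) (by positivity : 0 < 1 + 4 * e + e ^ 2)
    (by nlinarith : 0 < 1 - 4 * e + e ^ 2)
    (fun s hs => two_mul_inner_pullbackNormal_le hr hφ he hv (hp_le _ ⟨s, hs, rfl⟩))
    (le_two_mul_inner_pullbackNormal hr hφ he (by linarith) hv (hq_le _ ⟨p, hp, rfl⟩))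
  exact ⟨_, hτ, dist_add_smul_pullbackNormal_le hr hφ he he₄ hv
    (abs_sub_one_le_of_inv_le_of_le_inv he₀ he₄ hle hge)⟩

end NormalTransport

section Stability

variable {d : ℕ} {S : Set (EuclideanSpace ℝ (Fin d))} {z x : EuclideanSpace ℝ (Fin d)} {r M : ℝ}
  {φ ψ φ₁ ψ₁ φ₂ ψ₂ : EuclideanSpace ℝ (Fin d) → EuclideanSpace ℝ (Fin d)}

namespace IsDeformationPair

theorem infEDist_medialAxis_le (h : IsDeformationPair z r φ ψ) (hS : HasBoundingSphere S z r)
    (he : r * deformationSize φ ψ ≤ 1 / 4) (hx : x ∈ medialAxis (deformation φ '' S)) :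
    infEDist x (medialAxis S) ≤ ENNReal.ofReal
      (r * (6 * (r * deformationSize φ ψ) + 284 * (r * deformationSize φ ψ) ^ 2)) := by
  obtain ⟨y, hy, hxy⟩ := exists_mem_closure_medialAxis_dist_le hS.radius_pos h.mem_left
    (mul_le_mul_of_nonneg_left (lipDeriv_le_deformationSize φ ψ) hS.radius_pos.le) he hS.isClosed
    hx ((hS.image h).infDist_le_of_mem_medialAxis hx)
  rw [← infEDist_closure]
  refine (infEDist_le_edist_of_mem hy).trans ?_
  rw [edist_dist]
  exact ENNReal.ofReal_le_ofReal hxy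

theorem hausdorffEDist_medialAxis_image_le_of_mul_deformationSize_le
    (h : IsDeformationPair z r φ ψ) (hS : HasBoundingSphere S z r)
    (he : r * deformationSize φ ψ ≤ 1 / 4) :
    hausdorffEDist (medialAxis S) (medialAxis (deformation φ '' S)) ≤ ENNReal.ofReal
      (r * (6 * (r * deformationSize φ ψ) + 284 * (r * deformationSize φ ψ) ^ 2)) := by
  refine hausdorffEDist_le_of_infEDist (fun x hx => ?_)
    fun x hx => h.infEDist_medialAxis_le hS he hx
  rw [deformationSize_comm] at he ⊢
  rw [← h.leftInverse.image_image S] at hx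
  exact h.symm.infEDist_medialAxis_le (hS.image h) he hx

theorem hausdorffEDist_medialAxis_image_le_two_mul_radius (h : IsDeformationPair z r φ ψ)
    (hS : HasBoundingSphere S z r) :
    hausdorffEDist (medialAxis S) (medialAxis (deformation φ '' S)) ≤ ENNReal.ofReal (2 * r) := by
  have hball := hS.medialAxis_subset_ball
  have hball' := (hS.image h).medialAxis_subset_ball
  have hne := h.medialAxis_image_nonempty_iff hS
  have hedist {x y} (hx : x ∈ ball z r) (hy : y ∈ ball z r) : edist x y ≤ .ofReal (2 * r) := by
    rw [edist_dist]
    gcongr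
    linarith [dist_triangle_right x y z, mem_ball.1 hx, mem_ball.1 hy]
  refine hausdorffEDist_le_of_mem_edist (fun x hx => ?_) fun x hx => ?_
  · obtain ⟨y, hy⟩ := hne.2 ⟨x, hx⟩
    exact ⟨y, hy, hedist (hball hx) (hball' hy)⟩
  · obtain ⟨y, hy⟩ := hne.1 ⟨x, hx⟩
    exact ⟨y, hy, hedist (hball' hx) (hball hy)⟩

theorem hausdorffEDist_medialAxis_image_le (h : IsDeformationPair z r φ ψ)
    (hS : HasBoundingSphere S z r) :
    hausdorffEDist (medialAxis S) (medialAxis (deformation φ '' S)) ≤ ENNReal.ofReal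
      (r * (6 * (r * deformationSize φ ψ) + 284 * (r * deformationSize φ ψ) ^ 2)) := by
  obtain he | he := le_or_gt (r * deformationSize φ ψ) (1 / 4)
  · exact h.hausdorffEDist_medialAxis_image_le_of_mul_deformationSize_le hS he
  · refine (h.hausdorffEDist_medialAxis_image_le_two_mul_radius hS).trans
      (ENNReal.ofReal_le_ofReal ?_)
    rw [mul_comm]
    exact mul_le_mul_of_nonneg_left (by nlinarith) hS.radius_pos.le

theorem hausdorffEDist_medialAxis_image_le_linear (h : IsDeformationPair z r φ ψ)
    (hS : HasBoundingSphere S z r) :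
    hausdorffEDist (medialAxis S) (medialAxis (deformation φ '' S)) ≤
      ENNReal.ofReal (77 * r ^ 2 * deformationSize φ ψ) := by
  have hr := hS.radius_pos
  have he₀ : 0 ≤ r * deformationSize φ ψ := mul_nonneg hr.le (deformationSize_nonneg φ ψ)
  rw [show 77 * r ^ 2 * deformationSize φ ψ = r * (77 * (r * deformationSize φ ψ)) by ring]
  obtain he | he := le_or_gt (r * deformationSize φ ψ) (1 / 4)
  · refine (h.hausdorffEDist_medialAxis_image_le hS).trans (ENNReal.ofReal_le_ofReal ?_)
    exact mul_le_mul_of_nonneg_left (by nlinarith) hr.le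
  · refine (h.hausdorffEDist_medialAxis_image_le_two_mul_radius hS).trans
      (ENNReal.ofReal_le_ofReal ?_)
    rw [mul_comm]
    exact mul_le_mul_of_nonneg_left (by linarith) hr.le

theorem hausdorffEDist_medialAxis_image_image_le (h₁ : IsDeformationPair z r φ₁ ψ₁)
    (h₂ : IsDeformationPair z r φ₂ ψ₂) (hS : HasBoundingSphere S z r)
    (hM₁ : r * lipDeriv ψ₁ ≤ M) (hM₂ : r * lipDeriv ψ₂ ≤ M) :
    hausdorffEDist (medialAxis (deformation φ₁ '' S)) (medialAxis (deformation φ₂ '' S)) ≤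
      ENNReal.ofReal (77 * ((1 + M) ^ 2 + M) * r ^ 2 * lipDeriv (φ₁ - φ₂)) := by
  have hr := hS.radius_pos
  have himage : deformation ((φ₂ - φ₁) ∘ deformation ψ₁) '' (deformation φ₁ '' S) =
      deformation φ₂ '' S := by
    rw [h₁.deformation_comp, Set.image_comp, h₁.leftInverse.image_image]
  rw [← himage]
  refine ((h₁.comp hr h₂).hausdorffEDist_medialAxis_image_le_linear (hS.image h₁)).trans
    (ENNReal.ofReal_le_ofReal ?_)
  calc _ ≤ 77 * r ^ 2 * (((1 + M) ^ 2 + M) * lipDeriv (φ₁ - φ₂)) := by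
        gcongr
        exact h₁.deformationSize_comp_le hr h₂ hM₁ hM₂
    _ = _ := by ring

end IsDeformationPair

end Stability

theorem mainTheorem2_general :
    (∃ C : ℝ, 0 ≤ C ∧
      ∀ (d : ℕ) (S : Set (EuclideanSpace ℝ (Fin d))) (z : EuclideanSpace ℝ (Fin d)) (r : ℝ)
        (φ ψ : EuclideanSpace ℝ (Fin d) → EuclideanSpace ℝ (Fin d)),
        HasBoundingSphere S z r → IsDeformationPair z r φ ψ →
        hausdorffEDist (medialAxis S) (medialAxis (deformation φ '' S)) ≤
          ENNReal.ofReal ((1 + √50) * r ^ 2 * deformationSize φ ψ +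
            C * r ^ 3 * deformationSize φ ψ ^ 2)) ∧
    (∃ C : ℝ, 0 ≤ C ∧
      ∀ (d : ℕ) (S : Set (EuclideanSpace ℝ (Fin d))) (z : EuclideanSpace ℝ (Fin d)) (r : ℝ)
        (φ ψ : EuclideanSpace ℝ (Fin d) → EuclideanSpace ℝ (Fin d)),
        HasBoundingSphere S z r → IsDeformationPair z r φ ψ →
        hausdorffEDist (medialAxis S) (medialAxis (deformation φ '' S)) ≤
          ENNReal.ofReal (C * r ^ 2 * deformationSize φ ψ)) ∧
    (∀ M : ℝ, ∃ C : ℝ, 0 ≤ C ∧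
      ∀ (d : ℕ) (S : Set (EuclideanSpace ℝ (Fin d))) (z : EuclideanSpace ℝ (Fin d)) (r : ℝ)
        (φ₁ ψ₁ φ₂ ψ₂ : EuclideanSpace ℝ (Fin d) → EuclideanSpace ℝ (Fin d)),
        HasBoundingSphere S z r →
        IsDeformationPair z r φ₁ ψ₁ → r * lipDeriv ψ₁ ≤ M →
        IsDeformationPair z r φ₂ ψ₂ → r * lipDeriv ψ₂ ≤ M →
        hausdorffEDist (closure (medialAxis (deformation φ₁ '' S)))
            (closure (medialAxis (deformation φ₂ '' S))) ≤
          ENNReal.ofReal (C * r ^ 2 * lipDeriv (φ₁ - φ₂))) := by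
  refine ⟨⟨284, by norm_num, fun d S z r φ ψ hS h => ?_⟩,
    ⟨77, by norm_num, fun d S z r φ ψ hS h => h.hausdorffEDist_medialAxis_image_le_linear hS⟩,
    fun M => ⟨77 * ((1 + |M|) ^ 2 + |M|), by positivity,
      fun d S z r φ₁ ψ₁ φ₂ ψ₂ hS h₁ hM₁ h₂ hM₂ => ?_⟩⟩
  · have hsqrt : 5 ≤ √50 := Real.le_sqrt_of_sq_le (by norm_num)
    have hε := deformationSize_nonneg φ ψ
    refine (h.hausdorffEDist_medialAxis_image_le hS).trans (ENNReal.ofReal_le_ofReal ?_)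
    calc _ = (1 + 5) * r ^ 2 * deformationSize φ ψ + 284 * r ^ 3 * deformationSize φ ψ ^ 2 := by
          ring
      _ ≤ _ := by gcongr
  · rw [hausdorffEDist_closure]
    exact h₁.hausdorffEDist_medialAxis_image_image_le h₂ hS (hM₁.trans (le_abs_self M))
      (hM₂.trans (le_abs_self M))

theorem mainTheorem2 :
    (∃ C : ℝ, 0 ≤ C ∧
      ∀ (d : ℕ) (S : Set (EuclideanSpace ℝ (Fin d))) (z : EuclideanSpace ℝ (Fin d)) (r : ℝ)
        (φ ψ : EuclideanSpace ℝ (Fin d) → EuclideanSpace ℝ (Fin d)),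
        HasBoundingSphere S z r → IsDeformationPair z r φ ψ →
        r * deformationSize φ ψ ≤ 1 / 4 →
        Metric.hausdorffEDist (medialAxis S) (medialAxis (deformation φ '' S)) ≤
          ENNReal.ofReal ((1 + Real.sqrt 50) * r ^ 2 * deformationSize φ ψ +
            C * r ^ 3 * deformationSize φ ψ ^ 2)) ∧
    (∃ C : ℝ, 0 ≤ C ∧
      ∀ (d : ℕ) (S : Set (EuclideanSpace ℝ (Fin d))) (z : EuclideanSpace ℝ (Fin d)) (r : ℝ)
        (φ ψ : EuclideanSpace ℝ (Fin d) → EuclideanSpace ℝ (Fin d)),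
        HasBoundingSphere S z r → IsDeformationPair z r φ ψ →
        r * deformationSize φ ψ ≤ 1 / 4 →
        Metric.hausdorffEDist (medialAxis S) (medialAxis (deformation φ '' S)) ≤
          ENNReal.ofReal (C * r ^ 2 * deformationSize φ ψ)) ∧
    (∀ M : ℝ, ∃ C : ℝ, 0 ≤ C ∧
      ∀ (d : ℕ) (S : Set (EuclideanSpace ℝ (Fin d))) (z : EuclideanSpace ℝ (Fin d)) (r : ℝ)
        (φ₁ ψ₁ φ₂ ψ₂ : EuclideanSpace ℝ (Fin d) → EuclideanSpace ℝ (Fin d)),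
        HasBoundingSphere S z r →
        IsDeformationPair z r φ₁ ψ₁ → r * deformationSize φ₁ ψ₁ ≤ M →
        IsDeformationPair z r φ₂ ψ₂ → r * deformationSize φ₂ ψ₂ ≤ M →
        Metric.hausdorffEDist (closure (medialAxis (deformation φ₁ '' S)))
            (closure (medialAxis (deformation φ₂ '' S))) ≤
          ENNReal.ofReal (C * r ^ 2 * lipDeriv (φ₁ - φ₂))) := by
  obtain ⟨⟨C, hC, hquad⟩, ⟨C', hC', hlin⟩, hpair⟩ := mainTheorem2_general
  exact ⟨⟨C, hC, fun d S z r φ ψ hS h _ => hquad d S z r φ ψ hS h⟩,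
    ⟨C', hC', fun d S z r φ ψ hS h _ => hlin d S z r φ ψ hS h⟩,
    fun M => (hpair M).imp fun _ hC => ⟨hC.1, fun d S z r φ₁ ψ₁ φ₂ ψ₂ hS h₁ hM₁ h₂ hM₂ =>
      hC.2 d S z r φ₁ ψ₁ φ₂ ψ₂ hS
        h₁ ((mul_le_mul_of_nonneg_left (le_max_right _ _) hS.radius_pos.le).trans hM₁)
        h₂ ((mul_le_mul_of_nonneg_left (le_max_right _ _) hS.radius_pos.le).trans hM₂)⟩⟩
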